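/- **Setting.** All Hilbert spaces are finite-dimensional and nonzero. Let $f:\mathbb R\to\mathbb R\cup\{+\infty\}$ be convex and lower semicontinuous with $(0,\infty)\subseteq\operatorname{dom}(f):=\{t: f(t)<+\infty\}$. Let $f^*(z)=\sup_{t\in\operatorname{dom}(f)}\{tz-f(t)\}$ be its Fenchel conjugate, $\operatorname{dom}(f^*)=\{z\in\mathbb R: f^*(z)<+\infty\}$ and $\operatorname{range}(f^*)=\{f^*(z): z\in\operatorname{dom}(f^*)\}\subseteq\mathbb R$. For positive semidefinite $\rho,\sigma$ on the same space, the measured $f$-divergence is $$S_{\mathbb M,f}(\rho\|\sigma)=\sup_{\{M_x\}}\ \sum_x \operatorname{tr}[\sigma M_x]\, f\!\left(\frac{\operatorname{tr}[\rho M_x]}{\operatorname{tr}[\sigma M_x]}\right)\in(-\infty,+\infty],$$ where the supremum is over all POVMs (finite families $M_x\ge 0$ with $\sum_x M_x=I$), with the conventions $f(0)=\lim_{t\downarrow0}f(t)$, $0f(0/0)=0$ and $0f(a/0)=\lim_{t\downarrow0}tf(a/t)$ for $a>0$. For an operator $X_{AR}$ on $A\otimes R$ write $X_A=\operatorname{tr}_R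 X_{AR}$. A real function on an interval $J$ is called operator monotone (convex, concave) on $J$ if it is so, in the Loewner order, on Hermitian matrices of every size with spectrum in $J$. **Theorem 2 (Uhlmann's theorem for measured $f$-divergences).** 1. Suppose that $f^*$ is operator convex and operator monotone on $\operatorname{dom}(f^*)$ and that $\inf\operatorname{dom}(f^*)=-\infty$. Then for every density operator $\rho_A$ on $A$ and every positive semidefinite $\sigma_{AR}$ on $A\otimes R$, $$\inf_{\substack{\rho_{AR}\ge 0\\ \operatorname{tr}_R\rho_{AR}=\rho_A}} S_{\mathbb M,f}(\rho_{AR}\|\sigma_{AR})=S_{\mathbb M,f}(\rho_A\|\sigma_A).$$ 2. Suppose that $f^*:\operatorname{dom}(f^*)\to\operatorname{range}(f^*)$ is one-to-one, that $(f^*)^{-1}$ is operator concave and operator monotone on $\operatorname{range}(f^*)$, and that $\sup\operatorname{range}(f^*)=+\infty$. Then for every density operator $\rho_{AR}$ on $A\otimes R$ and every positive semidefinite $\sigma_A$ on $A$, $$\inf_{\substack{\sigma_{AR}\ge 0\\ \operatorname{tr}_R\sigma_{AR}=\sigma_A}} S_{\mathbb M,f}(\rho_{AR}\|\sigma_{AR})=S_{\mathbb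 M,f}(\rho_A\|\sigma_A).$$ In both cases the infimum is attained. -/

import Mathlib

open Filter Topology
open scoped ComplexOrder

noncomputable section

namespace MeasuredDivergence

/-! ### Convex functions with values in `ℝ ∪ {+∞}` and the Fenchel conjugate -/

/-- The effective domain `{t : f t < +∞}`. -/
def effDom (f : ℝ → EReal) : Set ℝ := {t | f t < ⊤}

/-- Convexity of an extended-real-valued function: its epigraph is convex. -/
def EConvex (f : ℝ → EReal) : Prop :=
  Convex ℝ {p : ℝ × ℝ | f p.1 ≤ (p.2 : EReal)}

/-- A function `f : ℝ → ℝ ∪ {+∞}` (so never `-∞`) which is convex, lower semicontinuous, and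
finite on `(0, ∞)`. -/
structure IsDivergenceFunction (f : ℝ → EReal) : Prop where
  ne_bot : ∀ t, f t ≠ ⊥
  convex : EConvex f
  lsc : LowerSemicontinuous f
  pos_subset_dom : Set.Ioi (0 : ℝ) ⊆ effDom f

/-- The Fenchel conjugate `f*(z) = sup {t z - f t : t ∈ dom f}`. -/
def fenchelConj (f : ℝ → EReal) (z : ℝ) : EReal :=
  ⨆ t ∈ effDom f, (((t * z : ℝ) : EReal) - f t)

/-- The Fenchel conjugate as a real-valued function; it is used only on `dom f*`. -/
def conjReal (f : ℝ → EReal) (z : ℝ) : ℝ := (fenchelConj f z).toReal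

/-- The domain `dom f*`. -/
def conjDom (f : ℝ → EReal) : Set ℝ := effDom (fenchelConj f)

/-- The range of `f* : dom f* → ℝ`. -/
def conjRange (f : ℝ → EReal) : Set ℝ := conjReal f '' conjDom f

/-- The inverse `(f*)⁻¹ : range f* → dom f*`; it is used only when `f*` is one-to-one on `dom f*`. -/
def conjInv (f : ℝ → EReal) : ℝ → ℝ := Function.invFunOn (conjReal f) (conjDom f)

/-! ### Operator convexity and operator monotonicity

`cfc g X` is `g` applied to the Hermitian matrix `X` through its spectral decomposition
(the spectrum is finite, so every `g` is continuous on it). -/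

/-- `g` is operator monotone on `J`: for Hermitian matrices of any size with spectrum in `J`,
`X ≤ Y` implies `g(X) ≤ g(Y)` in the Loewner order. -/
def OperatorMonotoneOn (J : Set ℝ) (g : ℝ → ℝ) : Prop :=
  ∀ (n : ℕ) (X Y : Matrix (Fin n) (Fin n) ℂ), X.IsHermitian → Y.IsHermitian →
    spectrum ℝ X ⊆ J → spectrum ℝ Y ⊆ J →
    (Y - X).PosSemidef → (cfc g Y - cfc g X).PosSemidef

/-- `g` is operator convex on the interval `J`: for Hermitian matrices of any size with spectrum
in `J` and `0 ≤ s ≤ 1`, `g(s X + (1 - s) Y) ≤ s g(X) + (1 - s) g(Y)` in the Loewner order. -/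
def OperatorConvexOn (J : Set ℝ) (g : ℝ → ℝ) : Prop :=
  ∀ (n : ℕ) (X Y : Matrix (Fin n) (Fin n) ℂ), X.IsHermitian → Y.IsHermitian →
    spectrum ℝ X ⊆ J → spectrum ℝ Y ⊆ J → ∀ s : ℝ, 0 ≤ s → s ≤ 1 →
    ((s • cfc g X + (1 - s) • cfc g Y) - cfc g (s • X + (1 - s) • Y)).PosSemidef

/-- `g` is operator concave on `J`: `-g` is operator convex on `J`. -/
def OperatorConcaveOn (J : Set ℝ) (g : ℝ → ℝ) : Prop :=
  OperatorConvexOn J (fun x => -g x)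

/-! ### Classical and measured `f`-divergences -/

/-- The summand `q f(p / q)` for `p, q ≥ 0`, with the conventions `f(0) = lim_{t ↓ 0} f(t)`,
`0 f(0/0) = 0` and `0 f(a/0) = lim_{t ↓ 0} t f(a/t)` for `a > 0`. -/
def fTerm (f : ℝ → EReal) (p q : ℝ) : EReal :=
  if q = 0 then
    if p = 0 then 0 else limUnder (𝓝[>] (0 : ℝ)) (fun t : ℝ => (t : EReal) * f (p / t))
  else
    if p = 0 then (q : EReal) * limUnder (𝓝[>] (0 : ℝ)) f else (q : EReal) * f (p / q)

/-- The classical `f`-divergence `S_f(P‖Q) = ∑ₓ Q(x) f(P(x) / Q(x))`. -/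
def fDiv {X : Type*} [Fintype X] (f : ℝ → EReal) (P Q : X → ℝ) : EReal :=
  ∑ x, fTerm f (P x) (Q x)

/-- A positive operator-valued measure with outcome set `X`. -/
def IsPOVM {X A : Type*} [Fintype X] [Fintype A] [DecidableEq A]
    (M : X → Matrix A A ℂ) : Prop :=
  (∀ x, (M x).PosSemidef) ∧ ∑ x, M x = 1

/-- The outcome distribution `P_{ρ,M}(x) = tr[ρ Mₓ]` (a real number for Hermitian `ρ`, `Mₓ`). -/
def outcome {X A : Type*} [Fintype A] (ρ : Matrix A A ℂ) (M : X → Matrix A A ℂ) (x : X) : ℝ :=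
  (ρ * M x).trace.re

/-- The measured `f`-divergence: the supremum of `S_f(P_{ρ,M}‖P_{σ,M})` over all POVMs `M`. -/
def measuredDiv {A : Type*} [Fintype A] [DecidableEq A] (f : ℝ → EReal)
    (ρ σ : Matrix A A ℂ) : EReal :=
  ⨆ (n : ℕ) (M : Fin n → Matrix A A ℂ) (_ : IsPOVM M), fDiv f (outcome ρ M) (outcome σ M)

/-! ### States and extensions -/

/-- Density operators: positive semidefinite with trace one. -/
def IsDensity {A : Type*} [Fintype A] (ρ : Matrix A A ℂ) : Prop :=
  ρ.PosSemidef ∧ ρ.trace = 1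

/-- The partial trace over the second tensor factor. -/
def partialTraceR {A R : Type*} [Fintype R] (X : Matrix (A × R) (A × R) ℂ) : Matrix A A ℂ :=
  Matrix.of fun i j => ∑ r, X (i, r) (j, r)

/-- The positive semidefinite extensions to `A ⊗ R` of an operator on `A`. -/
def extensions {A : Type*} (R : Type*) [Fintype R] (ρA : Matrix A A ℂ) :
    Set (Matrix (A × R) (A × R) ℂ) :=
  {X | X.PosSemidef ∧ partialTraceR X = ρA}

end MeasuredDivergence

end

open MeasuredDivergence

namespace MeasuredDivergence

open Matrix
open scoped Kronecker

/-! ### Functional calculus of Hermitian matrices by polynomial interpolation. -/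

section FunctionalCalculus

variable {m n : Type*} [Fintype m] [DecidableEq m] [Fintype n] [DecidableEq n]

/-! By Fenchel duality `q f(p/q) = sup_z (p z - q f*(z))` over `dom f*`, boundary conventions
included (`fTerm_eq_iSup`). Both parts thus become one statement about `T(p,q) = sup_{z ∈ J} (p G(z)
- q z)`, with `G` operator concave and monotone on an interval `J` unbounded above: `J = range f*`
and `G = (f*)⁻¹` in part 2; `J = -dom f*` and `G(w) = -f*(-w)`, with the arguments exchanged, in
part 1.

The measured version of `T` at `(P, N)` equals the supremum of `tr[P G(τ)] - tr[N τ]` over Hermitian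
`τ` with spectrum in `J`: the spectral measurement of `τ` gives one inequality, the operator Jensen
inequality for `τ = ∑ z_x M_x` the other.

Let `V` bound this expression for `(P_A, N)`. An extension `K` of `N` with the same bound for `(P,
K)` is a positive extension of the functional `Z ⊗ 1 ↦ tr[N Z]`, supplied by the M. Riesz extension
theorem (`exists_extension_variational_le`). Its hypothesis holds because `τ ≤ Z ⊗ 1` implies `tr[P
G(τ)] ≤ tr[P_A G(Z)] ≤ V + tr[N Z]`. One `K` serves all `τ`, so the infimum is attained. The reverse
inequality is data processing under the measurements `M_x ⊗ 1`. -/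

theorem exists_polynomial_eqOn (g : ℝ → ℝ) {S : Set ℝ} (hS : S.Finite) :
    ∃ p : Polynomial ℝ, ∀ x ∈ S, g x = p.eval x := by
  refine ⟨Lagrange.interpolate hS.toFinset id g, fun x hx => ?_⟩
  exact (Lagrange.eval_interpolate_at_node (v := id) g (Set.injOn_id _) (hS.mem_toFinset.2 hx)).symm

theorem cfc_eq_aeval {X : Matrix n n ℂ} (hX : X.IsHermitian) {g : ℝ → ℝ} {p : Polynomial ℝ}
    (h : ∀ x ∈ spectrum ℝ X, g x = p.eval x) : cfc g X = Polynomial.aeval X p := by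
  have hX' : IsSelfAdjoint X := hX
  rw [← cfc_polynomial p X hX']
  exact cfc_congr h

theorem aeval_mul_eq_mul_aeval {Y : Matrix m m ℂ} {Z : Matrix n n ℂ} {V : Matrix m n ℂ}
    (h : Y * V = V * Z) (p : Polynomial ℝ) :
    Polynomial.aeval Y p * V = V * Polynomial.aeval Z p := by
  have hpow : ∀ k : ℕ, Y ^ k * V = V * Z ^ k := by
    intro k
    induction k with
    | zero => simp
    | succ k ih => rw [pow_succ, Matrix.mul_assoc, h, ← Matrix.mul_assoc, ih, Matrix.mul_assoc,
        ← pow_succ]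
  induction p using Polynomial.induction_on' with
  | add p q hp hq => rw [map_add, map_add, Matrix.add_mul, Matrix.mul_add, hp, hq]
  | monomial k a =>
    simp only [Polynomial.aeval_monomial, ← Algebra.smul_def, Matrix.smul_mul, Matrix.mul_smul,
      hpow]

/-- A single polynomial interpolates `g` on both finite spectra, and polynomials respect
intertwining. -/
theorem cfc_mul_eq_mul_cfc (g : ℝ → ℝ) {Y : Matrix m m ℂ} {Z : Matrix n n ℂ} {V : Matrix m n ℂ}
    (hY : Y.IsHermitian) (hZ : Z.IsHermitian) (h : Y * V = V * Z) :
    cfc g Y * V = V * cfc g Z := by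
  obtain ⟨p, hp⟩ := exists_polynomial_eqOn g
    ((Matrix.finite_real_spectrum (A := Y)).union (Matrix.finite_real_spectrum (A := Z)))
  rw [cfc_eq_aeval hY fun x hx => hp x (Or.inl hx), cfc_eq_aeval hZ fun x hx => hp x (Or.inr hx)]
  exact aeval_mul_eq_mul_aeval h p

theorem spectrum_reindex (e : n ≃ m) (X : Matrix n n ℂ) :
    spectrum ℝ (reindex e e X) = spectrum ℝ X :=
  AlgEquiv.spectrum_eq (reindexAlgEquiv ℝ ℂ e) X

theorem cfc_reindex (g : ℝ → ℝ) (e : n ≃ m) {X : Matrix n n ℂ} (hX : X.IsHermitian) :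
    cfc g (reindex e e X) = reindex e e (cfc g X) := by
  obtain ⟨p, hp⟩ := exists_polynomial_eqOn g (Matrix.finite_real_spectrum (A := X))
  have hX' : (reindex e e X).IsHermitian := by
    simpa [reindex_apply] using hX.submatrix e.symm
  rw [cfc_eq_aeval hX hp, cfc_eq_aeval hX' (p := p) fun x hx => hp x (by rwa [spectrum_reindex] at hx)]
  exact Polynomial.aeval_algHom_apply (reindexAlgEquiv ℝ ℂ e) X p

theorem isHermitian_diagonal_ofReal {n : Type*} [DecidableEq n] (d : n → ℝ) :
    (diagonal fun i => (d i : ℂ)).IsHermitian := by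
  apply isHermitian_diagonal_of_self_adjoint
  ext i
  simp

theorem spectrum_diagonal_ofReal (d : n → ℝ) :
    spectrum ℝ (diagonal fun i => (d i : ℂ)) = Set.range d := by
  ext x
  rw [← spectrum.algebraMap_mem_iff ℂ, _root_.spectrum_diagonal]
  simp

theorem cfc_diagonal_ofReal (g : ℝ → ℝ) (d : n → ℝ) :
    cfc g (diagonal fun i => (d i : ℂ)) = diagonal fun i => (g (d i) : ℂ) := by
  obtain ⟨p, hp⟩ := exists_polynomial_eqOn g
    (Matrix.finite_real_spectrum (A := diagonal fun i => (d i : ℂ)))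
  rw [cfc_eq_aeval (isHermitian_diagonal_ofReal d) hp]
  have h := Polynomial.aeval_algHom_apply (diagonalAlgHom (n := n) (α := ℂ) ℝ)
    (fun i => (d i : ℂ)) p
  rw [diagonalAlgHom_apply] at h
  rw [h, diagonalAlgHom_apply]
  congr 1
  ext i
  rw [hp (d i) (by rw [spectrum_diagonal_ofReal]; exact ⟨i, rfl⟩)]
  have h' := Polynomial.aeval_algHom_apply (Pi.evalAlgHom ℝ (fun _ : n => ℂ) i)
    (fun i => (d i : ℂ)) p
  refine h'.symm.trans ?_
  exact (Polynomial.aeval_algebraMap_apply ℂ (d i) p).trans (by simp)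

/-- The spectral measurement of a Hermitian matrix. -/
theorem exists_spectral_povm {X : Matrix n n ℂ} (hX : X.IsHermitian) :
    ∃ (M : n → Matrix n n ℂ) (d : n → ℝ), IsPOVM M ∧ (∀ i, d i ∈ spectrum ℝ X) ∧
      ∀ g : ℝ → ℝ, cfc g X = ∑ i, (g (d i)) • M i := by
  set U : Matrix n n ℂ := (hX.eigenvectorUnitary : Matrix n n ℂ) with hU
  have hUU : U * Uᴴ = 1 := Unitary.coe_mul_star_self hX.eigenvectorUnitary
  have hsum : ∀ g : n → ℝ, U * diagonal (fun i => (g i : ℂ)) * Uᴴ =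
      ∑ i, g i • (U * diagonal (Pi.single i 1) * Uᴴ) := by
    intro g
    have : diagonal (fun i => (g i : ℂ)) = ∑ i, g i • diagonal (Pi.single i (1 : ℂ)) := by
      ext a b
      rw [Matrix.sum_apply]
      by_cases hab : a = b
      · subst hab
        simp [Pi.single_apply]
      · simp [hab]
    rw [this, Matrix.mul_sum, Matrix.sum_mul]
    simp
  refine ⟨fun i => U * diagonal (Pi.single i 1) * Uᴴ, hX.eigenvalues, ⟨fun i => ?_, ?_⟩,
    fun i => hX.eigenvalues_mem_spectrum_real i, fun g => ?_⟩
  · refine PosSemidef.mul_mul_conjTranspose_same (PosSemidef.diagonal ?_) U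
    exact Pi.single_nonneg.2 zero_le_one
  · have := hsum fun _ => 1
    simp only [one_smul, Complex.ofReal_one, diagonal_one, Matrix.mul_one] at this
    rw [← this, hUU]
  · rw [hX.cfc_eq, IsHermitian.cfc, Unitary.conjStarAlgAut_apply]
    exact hsum fun i => g (hX.eigenvalues i)

end FunctionalCalculus

/-! ### Spectra in an interval, tested on the numerical range. -/

section NumericalRange

variable {n : Type*} [Fintype n] [DecidableEq n]

theorem cfc_id_real {X : Matrix n n ℂ} (hX : X.IsHermitian) : cfc (fun x : ℝ => x) X = X :=
  cfc_id' ℝ X hX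

/-- The weights `⟨v, M_y v⟩` form a probability distribution. -/
theorem povm_re_mem {A Y : Type*} [Fintype A] [DecidableEq A] [Fintype Y] {J : Set ℝ}
    (hJ : Convex ℝ J) {M : Y → Matrix A A ℂ} (hM : IsPOVM M) {z : Y → ℝ} (hz : ∀ y, z y ∈ J)
    {v : A → ℂ} (hv : star v ⬝ᵥ v = 1) : (star v ⬝ᵥ ((∑ y, z y • M y) *ᵥ v)).re ∈ J := by
  have h1 : (star v ⬝ᵥ ((∑ y, z y • M y) *ᵥ v)).re =
      ∑ y, (star v ⬝ᵥ (M y *ᵥ v)).re • z y := by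
    rw [Matrix.sum_mulVec, dotProduct_sum, Complex.re_sum]
    refine Finset.sum_congr rfl fun y _ => ?_
    rw [Matrix.smul_mulVec, dotProduct_smul, Complex.smul_re, smul_eq_mul, smul_eq_mul, mul_comm]
  rw [h1]
  refine hJ.sum_mem (fun y _ => (hM.1 y).re_dotProduct_nonneg v) ?_ fun y _ => hz y
  have : ∑ y, star v ⬝ᵥ (M y *ᵥ v) = 1 := by
    rw [← dotProduct_sum, ← Matrix.sum_mulVec, hM.2, Matrix.one_mulVec, hv]
  rw [← Complex.re_sum, this, Complex.one_re]

theorem spectrum_subset_iff {X : Matrix n n ℂ} (hX : X.IsHermitian) {J : Set ℝ}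
    (hJ : Convex ℝ J) :
    spectrum ℝ X ⊆ J ↔ ∀ v : n → ℂ, star v ⬝ᵥ v = 1 → (star v ⬝ᵥ (X *ᵥ v)).re ∈ J := by
  constructor
  · intro h v hv
    obtain ⟨M, d, hM, hd, hg⟩ := exists_spectral_povm hX
    have := hg fun x => x
    rw [cfc_id_real hX] at this
    rw [this]
    exact povm_re_mem hJ hM (fun i => h (hd i)) hv
  · rw [hX.spectrum_real_eq_range_eigenvalues]
    rintro h _ ⟨i, rfl⟩
    rw [hX.eigenvalues_eq]
    refine h _ ?_
    have h1 := hX.eigenvectorBasis.orthonormal.1 i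
    have h2 := EuclideanSpace.inner_eq_star_dotProduct (hX.eigenvectorBasis i)
      (hX.eigenvectorBasis i)
    rw [dotProduct_comm, ← h2, inner_self_eq_norm_sq_to_K, h1]
    simp

end NumericalRange

/-! ### Operator monotone and concave functions; the operator Jensen inequality. -/

section OperatorFunctions

variable {n : Type*}

theorem isHermitian_real_smul {X : Matrix n n ℂ} (hX : X.IsHermitian) (c : ℝ) :
    (c • X).IsHermitian := by
  rw [IsHermitian, conjTranspose_smul, hX.eq, star_trivial]

theorem posSemidef_real_smul {X : Matrix n n ℂ} (hX : X.PosSemidef) {c : ℝ} (hc : 0 ≤ c) :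
    (c • X).PosSemidef := by
  have h := hX.smul (a := (c : ℂ)) (by exact_mod_cast hc)
  rwa [show (c : ℂ) • X = c • X from by ext; simp] at h

theorem posSemidef_reindex_iff {m : Type*} (e : n ≃ m) {X : Matrix n n ℂ} :
    (reindex e e X).PosSemidef ↔ X.PosSemidef := by
  rw [reindex_apply, posSemidef_submatrix_equiv]

theorem isHermitian_reindex {m : Type*} (e : n ≃ m) {X : Matrix n n ℂ} (hX : X.IsHermitian) :
    (reindex e e X).IsHermitian := by
  simpa [reindex_apply] using hX.submatrix e.symm

variable [Fintype n] [DecidableEq n] {J : Set ℝ} {g : ℝ → ℝ}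

theorem OperatorMonotoneOn.posSemidef_sub (h : OperatorMonotoneOn J g) {X Y : Matrix n n ℂ}
    (hX : X.IsHermitian) (hY : Y.IsHermitian) (hXJ : spectrum ℝ X ⊆ J) (hYJ : spectrum ℝ Y ⊆ J)
    (hXY : (Y - X).PosSemidef) : (cfc g Y - cfc g X).PosSemidef := by
  let e := Fintype.equivFin n
  have h1 := h _ (reindex e e X) (reindex e e Y) (isHermitian_reindex e hX)
    (isHermitian_reindex e hY) (by rwa [spectrum_reindex]) (by rwa [spectrum_reindex])
    ((posSemidef_reindex_iff e).2 hXY)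
  rw [cfc_reindex g e hX, cfc_reindex g e hY] at h1
  exact (posSemidef_reindex_iff e).1 h1

theorem OperatorConcaveOn.posSemidef_sub (h : OperatorConcaveOn J g) {X Y : Matrix n n ℂ}
    (hX : X.IsHermitian) (hY : Y.IsHermitian) (hXJ : spectrum ℝ X ⊆ J) (hYJ : spectrum ℝ Y ⊆ J)
    {s : ℝ} (hs0 : 0 ≤ s) (hs1 : s ≤ 1) :
    (cfc g (s • X + (1 - s) • Y) - (s • cfc g X + (1 - s) • cfc g Y)).PosSemidef := by
  let e := Fintype.equivFin n
  have h1 := h _ (reindex e e X) (reindex e e Y) (isHermitian_reindex e hX)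
    (isHermitian_reindex e hY) (by rwa [spectrum_reindex]) (by rwa [spectrum_reindex]) s hs0 hs1
  have hlin : s • reindex e e X + (1 - s) • reindex e e Y =
      reindex e e (s • X + (1 - s) • Y) := rfl
  rw [hlin, cfc_neg, cfc_neg, cfc_neg, cfc_reindex g e hX, cfc_reindex g e hY, cfc_reindex g e
    ((isHermitian_real_smul hX s).add (isHermitian_real_smul hY (1 - s)))] at h1
  refine (posSemidef_reindex_iff e).1 ?_
  convert h1 using 1
  change reindex e e _ = s • -reindex e e (cfc g X) + (1 - s) • -reindex e e (cfc g Y) -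
    -reindex e e (cfc g (s • X + (1 - s) • Y))
  rw [smul_neg, smul_neg, sub_neg_eq_add, ← neg_add, neg_add_eq_sub]
  rfl

theorem cfc_neg_comp_neg (g : ℝ → ℝ) {X : Matrix n n ℂ} (hX : X.IsHermitian) :
    cfc (fun x => -g (-x)) X = -cfc g (-X) := by
  rw [cfc_neg]
  exact congrArg _ (cfc_comp_neg g X
    (((Matrix.finite_real_spectrum (A := X)).image _).continuousOn g) hX)

/-- With its convex counterpart below, this puts `f*` of part 1 into the concave form common to both
parts. -/
theorem OperatorMonotoneOn.neg_comp_neg (h : OperatorMonotoneOn J g) :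
    OperatorMonotoneOn (-J) fun x => -g (-x) := by
  intro n X Y hX hY hXJ hYJ hXY
  rw [cfc_neg_comp_neg g hX, cfc_neg_comp_neg g hY]
  have := h n (-Y) (-X) hY.neg hX.neg
    (by rw [← spectrum.neg_eq]; intro x hx; simpa using hYJ hx)
    (by rw [← spectrum.neg_eq]; intro x hx; simpa using hXJ hx)
    (by rwa [neg_sub_neg])
  rwa [neg_sub_neg]

theorem OperatorConvexOn.neg_comp_neg (h : OperatorConvexOn J g) :
    OperatorConcaveOn (-J) fun x => -g (-x) := by
  intro n X Y hX hY hXJ hYJ s hs0 hs1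
  have := h n (-X) (-Y) hX.neg hY.neg
    (by rw [← spectrum.neg_eq]; intro x hx; simpa using hXJ hx)
    (by rw [← spectrum.neg_eq]; intro x hx; simpa using hYJ hx) s hs0 hs1
  have hc : ∀ Z : Matrix (Fin n) (Fin n) ℂ, Z.IsHermitian →
      cfc (fun x => -(-g (-x))) Z = cfc g (-Z) := by
    intro Z hZ
    rw [cfc_neg, cfc_neg_comp_neg g hZ, neg_neg]
  rw [hc X hX, hc Y hY, hc _ ((isHermitian_real_smul hX s).add (isHermitian_real_smul hY (1 - s)))]
  rwa [smul_neg, smul_neg, ← neg_add] at this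

/-- The operator Jensen inequality for a positive operator-valued measure. -/
theorem OperatorConcaveOn.jensen (h : OperatorConcaveOn J g) {Y : Type*}
    [Fintype Y] [DecidableEq Y] {M : Y → Matrix n n ℂ} (hM : IsPOVM M) {z : Y → ℝ}
    (hz : ∀ y, z y ∈ J) :
    (cfc g (∑ y, z y • M y) - ∑ y, g (z y) • M y).PosSemidef := by
  have hsq : ∀ y, ∃ B : Matrix n n ℂ, M y = Bᴴ * B := by
    intro y
    open scoped MatrixOrder in
    exact CStarAlgebra.nonneg_iff_eq_star_mul_self.mp (hM.1 y).nonneg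
  choose B hB using hsq
  -- Naimark dilation: stacking the factors `B y` gives an isometry `V` that compresses the diagonal
  -- matrix `D z` to `τ`.
  let V : Matrix (Y × n) n ℂ := of fun p b => B p.1 p.2 b
  let D : (Y → ℝ) → Matrix (Y × n) (Y × n) ℂ := fun d => diagonal fun p => (d p.1 : ℂ)
  have hVD : ∀ d : Y → ℝ, Vᴴ * (D d * V) = ∑ y, d y • M y := by
    intro d
    ext a b
    rw [Matrix.mul_apply]
    simp only [D, V, diagonal_mul, conjTranspose_apply, of_apply]
    simp only [Fintype.sum_prod_type, Matrix.sum_apply, Matrix.smul_apply, hB, Matrix.mul_apply,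
      conjTranspose_apply, Finset.smul_sum]
    refine Finset.sum_congr rfl fun y _ => Finset.sum_congr rfl fun c _ => ?_
    rw [Complex.real_smul]
    ring
  have hVV : Vᴴ * V = 1 := by
    have := hVD fun _ => 1
    simpa [D, hM.2] using this
  set τ := ∑ y, z y • M y with hτ
  have hDH : (D z).IsHermitian := isHermitian_diagonal_ofReal _
  have hτH : τ.IsHermitian := by
    rw [hτ, ← hVD z, ← Matrix.mul_assoc]
    exact isHermitian_conjTranspose_mul_mul V hDH
  -- The reflection in the range of `V`. Averaging `D z` with its conjugate by `W` removes the
  -- off-diagonal blocks, so the average `T` satisfies `T V = V τ`. Midpoint concavity, compressed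
  -- by `V`, is then the claim.
  let W : Matrix (Y × n) (Y × n) ℂ := (2 : ℝ) • (V * Vᴴ) - 1
  have hWV : W * V = V := by
    simp only [W, Matrix.sub_mul, Matrix.smul_mul, Matrix.mul_assoc, hVV, Matrix.mul_one,
      Matrix.one_mul]
    rw [two_smul, add_sub_cancel_right]
  have hWH : Wᴴ = W := by
    simp only [W, conjTranspose_sub, conjTranspose_smul, conjTranspose_mul,
      conjTranspose_conjTranspose, conjTranspose_one, star_trivial]
  have hVW : Vᴴ * W = Vᴴ := by
    rw [← hWH, ← conjTranspose_mul, hWV]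
  have hWW : W * W = 1 := by
    calc W * W = (2 : ℝ) • (W * V * Vᴴ) - W := by
          nth_rewrite 2 [show W = (2 : ℝ) • (V * Vᴴ) - 1 from rfl]
          rw [Matrix.mul_sub, Matrix.mul_smul, Matrix.mul_one, Matrix.mul_assoc]
      _ = 1 := by rw [hWV]; exact sub_sub_cancel _ _
  have hDJ : spectrum ℝ (D z) ⊆ J := by
    rw [show spectrum ℝ (D z) = _ from spectrum_diagonal_ofReal fun p : Y × n => z p.1]
    rintro _ ⟨p, rfl⟩
    exact hz p.1
  have hD'H : (W * D z * W).IsHermitian := by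
    have := isHermitian_conjTranspose_mul_mul W hDH
    rwa [hWH] at this
  have hD'J : spectrum ℝ (W * D z * W) ⊆ J := by
    have := spectrum.units_conjugate (R := ℝ) (a := D z) (u := ⟨W, W, hWW, hWW⟩)
    exact this.trans_subset hDJ
  have hcD : cfc g (D z) = D fun y => g (z y) := cfc_diagonal_ofReal g _
  have hcD' : cfc g (W * D z * W) = W * cfc g (D z) * W := by
    have := cfc_mul_eq_mul_cfc g (V := W) hD'H hDH
      (by rw [Matrix.mul_assoc, hWW, Matrix.mul_one])
    rw [← this, Matrix.mul_assoc _ W W, hWW, Matrix.mul_one]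
  set T := (1 / 2 : ℝ) • D z + (1 - 1 / 2 : ℝ) • (W * D z * W) with hT
  have hTH : T.IsHermitian := (isHermitian_real_smul hDH _).add (isHermitian_real_smul hD'H _)
  have hTV : T * V = V * τ := by
    have h1 : W * D z * W * V = (2 : ℝ) • (V * τ) - D z * V := by
      rw [Matrix.mul_assoc, hWV, Matrix.mul_assoc]
      simp only [W, Matrix.sub_mul, Matrix.smul_mul, Matrix.one_mul, Matrix.mul_assoc, hVD]
      rfl
    rw [hT, Matrix.add_mul, Matrix.smul_mul, Matrix.smul_mul, h1]
    module
  have hcT := cfc_mul_eq_mul_cfc g hTH hτH hTV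
  have key := (h.posSemidef_sub hDH hD'H hDJ hD'J (s := 1 / 2) (by norm_num)
    (by norm_num)).conjTranspose_mul_mul_same V
  rw [← hT, hcD', hcD] at key
  convert key using 1
  rw [Matrix.mul_assoc, Matrix.sub_mul, Matrix.mul_sub, hcT, ← Matrix.mul_assoc Vᴴ V, hVV,
    Matrix.one_mul, ← hVD fun y => g (z y)]
  congr 1
  rw [Matrix.add_mul, Matrix.mul_add, Matrix.smul_mul, Matrix.smul_mul, Matrix.mul_smul,
    Matrix.mul_smul]
  rw [Matrix.mul_assoc (W * _) W V, hWV, Matrix.mul_assoc W, ← Matrix.mul_assoc Vᴴ W, hVW]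
  module

end OperatorFunctions

/-! ### Partial trace and operators `Z ⊗ 1`. -/

section PartialTrace

variable {A R : Type*} [Fintype A] [DecidableEq A] [Fintype R] [DecidableEq R]

omit [DecidableEq A] in
theorem trace_mul_kronecker_one (N : Matrix (A × R) (A × R) ℂ) (Z : Matrix A A ℂ) :
    (N * (Z ⊗ₖ (1 : Matrix R R ℂ))).trace = (partialTraceR N * Z).trace := by
  simp only [Matrix.trace, Matrix.diag_apply, Matrix.mul_apply, kroneckerMap_apply,
    Fintype.sum_prod_type, partialTraceR, of_apply, Finset.sum_mul, Matrix.one_apply]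
  refine Finset.sum_congr rfl fun a _ => ?_
  rw [Finset.sum_comm]
  refine Finset.sum_congr rfl fun b _ => Finset.sum_congr rfl fun r _ => ?_
  simp

omit [Fintype A] [DecidableEq A] in
theorem partialTraceR_kronecker_single (N : Matrix A A ℂ) (r : R) :
    partialTraceR (N ⊗ₖ (single r r 1 : Matrix R R ℂ)) = N := by
  ext a b
  simp [partialTraceR, Matrix.single_apply]

omit [Fintype A] [Fintype R] [DecidableEq A] in
theorem isHermitian_kronecker_one {Z : Matrix A A ℂ} (hZ : Z.IsHermitian) :
    (Z ⊗ₖ (1 : Matrix R R ℂ)).IsHermitian := by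
  rw [IsHermitian, conjTranspose_kronecker, hZ.eq, conjTranspose_one]

theorem cfc_kronecker_one (g : ℝ → ℝ) {Z : Matrix A A ℂ} (hZ : Z.IsHermitian) :
    cfc g (Z ⊗ₖ (1 : Matrix R R ℂ)) = cfc g Z ⊗ₖ (1 : Matrix R R ℂ) := by
  -- `V r` is the embedding `a ↦ a ⊗ e_r`, which intertwines `Z ⊗ 1` with `Z`.
  let V : R → Matrix (A × R) A ℂ := fun r => of fun p b => if p.1 = b ∧ p.2 = r then 1 else 0
  have hV : ∀ (T : Matrix (A × R) (A × R) ℂ) r p b, (T * V r) p b = T p (b, r) := by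
    intro T r p b
    simp [Matrix.mul_apply, V, Fintype.sum_prod_type, ite_and]
  have hV' : ∀ (T : Matrix A A ℂ) r p b, (V r * T) p b = if p.2 = r then T p.1 b else 0 := by
    intro T r p b
    simp [Matrix.mul_apply, V, ite_and]
  ext p ⟨b, r⟩
  have := cfc_mul_eq_mul_cfc g (V := V r) (isHermitian_kronecker_one (R := R) hZ) hZ (by
    ext p b
    rw [hV, hV', kroneckerMap_apply, Matrix.one_apply]
    simp)
  rw [← hV (cfc g (Z ⊗ₖ (1 : Matrix R R ℂ))) r p b, this, hV', kroneckerMap_apply, Matrix.one_apply]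
  simp

omit [Fintype A] [Fintype R] [DecidableEq A] in
theorem posSemidef_of_kronecker_one [Nonempty R] {Z : Matrix A A ℂ}
    (h : (Z ⊗ₖ (1 : Matrix R R ℂ)).PosSemidef) : Z.PosSemidef := by
  obtain ⟨r⟩ := ‹Nonempty R›
  convert h.submatrix fun a => (a, r) using 1
  ext a b
  simp

omit [DecidableEq A] in
theorem extensions_kronecker_single {N : Matrix A A ℂ} (hN : N.PosSemidef) (r : R) :
    N ⊗ₖ (single r r 1 : Matrix R R ℂ) ∈ extensions R N := by
  refine ⟨hN.kronecker ?_, partialTraceR_kronecker_single N r⟩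
  rw [← Matrix.diagonal_single]
  exact PosSemidef.diagonal (Pi.single_nonneg.2 zero_le_one)

end PartialTrace

/-! ### Duality under the real trace pairing. -/

section TracePairing

variable {n : Type*} [Fintype n]

theorem re_trace_mul_nonneg {P Q : Matrix n n ℂ} (hP : P.PosSemidef) (hQ : Q.PosSemidef) :
    0 ≤ (P * Q).trace.re := by
  classical
  obtain ⟨B, rfl⟩ : ∃ B : Matrix n n ℂ, P = Bᴴ * B := by
    open scoped MatrixOrder in
    exact CStarAlgebra.nonneg_iff_eq_star_mul_self.mp hP.nonneg
  rw [Matrix.mul_assoc, Matrix.trace_mul_comm]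
  exact (Complex.nonneg_iff.1 (hQ.mul_mul_conjTranspose_same B).trace_nonneg).1

theorem exists_re_trace_mul_eq [DecidableEq n] (l : Matrix n n ℂ →ₗ[ℝ] ℝ) :
    ∃ N : Matrix n n ℂ, ∀ X, l X = (N * X).trace.re := by
  -- The sign comes from `Re(N_ji X_ij) = Re N_ji Re X_ij - Im N_ji Im X_ij`.
  refine ⟨of fun j i => ⟨l (single i j 1), -l (single i j Complex.I)⟩, fun X => ?_⟩
  conv_lhs => rw [Matrix.matrix_eq_sum_single X]
  simp only [map_sum, Matrix.trace, Matrix.diag_apply, Matrix.mul_apply, of_apply, Complex.re_sum]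
  rw [Finset.sum_comm]
  refine Finset.sum_congr rfl fun j _ => Finset.sum_congr rfl fun i _ => ?_
  have : single i j (X i j) = (X i j).re • single i j (1 : ℂ) + (X i j).im • single i j Complex.I := by
    rw [Matrix.smul_single, Matrix.smul_single, ← Matrix.single_add]
    congr 1
    simp [Complex.re_add_im]
  rw [this, map_add, map_smul, map_smul, Complex.mul_re]
  simp
  ring

theorem eq_of_re_trace_mul [DecidableEq n] {N N' : Matrix n n ℂ}
    (h : ∀ X, (N * X).trace.re = (N' * X).trace.re) : N = N' := by
  ext j i
  have h1 := h (single i j 1)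
  have h2 := h (single i j Complex.I)
  simp only [Matrix.trace_mul_single] at h1 h2
  apply Complex.ext
  · simpa using h1
  · simpa using h2

theorem re_trace_conjTranspose_mul (N X : Matrix n n ℂ) :
    (Nᴴ * X).trace.re = (N * Xᴴ).trace.re := by
  rw [show Nᴴ * X = (Xᴴ * N)ᴴ by simp, Matrix.trace_conjTranspose, Matrix.trace_mul_comm]
  simp

theorem posSemidef_of_re_trace_mul_nonneg [DecidableEq n] {N : Matrix n n ℂ}
    (hadj : ∀ X, (N * Xᴴ).trace.re = (N * X).trace.re)
    (hpos : ∀ X, X.PosSemidef → 0 ≤ (N * X).trace.re) : N.PosSemidef := by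
  have hN : N.IsHermitian := eq_of_re_trace_mul fun X => by
    rw [re_trace_conjTranspose_mul, hadj]
  refine PosSemidef.of_dotProduct_mulVec_nonneg hN fun v => ?_
  rw [Complex.nonneg_iff]
  refine ⟨?_, (hN.im_star_dotProduct_mulVec_self v).symm⟩
  have := hpos _ (posSemidef_vecMulVec_self_star v)
  rwa [Matrix.mul_vecMulVec, Matrix.trace_vecMulVec, dotProduct_comm] at this

end TracePairing

/-! ### The extension operator from the M. Riesz extension theorem. -/

section Extension

variable {n : Type*} [Fintype n] [DecidableEq n] {J : Set ℝ} {G : ℝ → ℝ}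

theorem spectrum_convexCombination_subset (hJ : Convex ℝ J) {X Y : Matrix n n ℂ}
    (hX : X.IsHermitian) (hY : Y.IsHermitian) (hXJ : spectrum ℝ X ⊆ J) (hYJ : spectrum ℝ Y ⊆ J)
    {a b : ℝ} (ha : 0 ≤ a) (hb : 0 ≤ b) (hab : a + b = 1) :
    spectrum ℝ (a • X + b • Y) ⊆ J := by
  rw [spectrum_subset_iff ((isHermitian_real_smul hX a).add (isHermitian_real_smul hY b)) hJ]
  intro v hv
  have h1 := (spectrum_subset_iff hX hJ).1 hXJ v hv
  have h2 := (spectrum_subset_iff hY hJ).1 hYJ v hv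
  have h3 := hJ h1 h2 ha hb hab
  rw [Matrix.add_mulVec, dotProduct_add, Matrix.smul_mulVec, Matrix.smul_mulVec, dotProduct_smul,
    dotProduct_smul, Complex.add_re, Complex.smul_re, Complex.smul_re]
  exact h3

theorem mem_of_convex_of_not_bddAbove (hJ : Convex ℝ J) (hJb : ¬ BddAbove J) {x y : ℝ} (hx : x ∈ J)
    (hxy : x ≤ y) : y ∈ J := by
  obtain ⟨w, hw, hyw⟩ := not_bddAbove_iff.1 hJb y
  exact hJ.ordConnected.out hx hw ⟨hxy, hyw.le⟩

/-- An interval unbounded above is closed upwards, so `G` stays applicable to every operator above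
one in its domain. -/
theorem spectrum_subset_of_posSemidef_sub (hJ : Convex ℝ J) (hJb : ¬ BddAbove J)
    {X Y : Matrix n n ℂ} (hX : X.IsHermitian) (hXJ : spectrum ℝ X ⊆ J)
    (h : (Y - X).PosSemidef) : Y.IsHermitian ∧ spectrum ℝ Y ⊆ J := by
  have hY : Y.IsHermitian := by simpa using h.1.add hX
  refine ⟨hY, (spectrum_subset_iff hY hJ).2 fun v hv => ?_⟩
  refine mem_of_convex_of_not_bddAbove hJ hJb ((spectrum_subset_iff hX hJ).1 hXJ v hv) ?_
  have := h.re_dotProduct_nonneg v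
  rw [Matrix.sub_mulVec, dotProduct_sub, map_sub] at this
  exact sub_nonneg.1 this

/-- The cone of all `(X, r)` such that `(X + Xᴴ) / 2 ≥ t τ` and `r ≥ t (V - tr[P G(τ)])` for some
`t ≥ 0` and some Hermitian `τ` with spectrum in `J`. -/
def variationalCone (hJ : Convex ℝ J) (hJne : J.Nonempty) (hG : OperatorConcaveOn J G)
    {P : Matrix n n ℂ} (hP : P.PosSemidef) (V : ℝ) : PointedCone ℝ (Matrix n n ℂ × ℝ) where
  carrier := {p | ∃ t : ℝ, 0 ≤ t ∧ ∃ τ : Matrix n n ℂ, τ.IsHermitian ∧ spectrum ℝ τ ⊆ J ∧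
    (p.1 + p.1ᴴ - (2 * t) • τ).PosSemidef ∧ t * (V - (P * cfc G τ).trace.re) ≤ p.2}
  add_mem' := by
    rintro ⟨X, r⟩ ⟨Y, s⟩ ⟨a, ha, σ, hσ, hσJ, hXσ, hr⟩ ⟨b, hb, τ, hτ, hτJ, hYτ, hs⟩
    -- If both scales vanish, the operators `σ` and `τ` drop out. Otherwise they merge into their
    -- weighted average, and operator concavity of `G` bounds the second coordinate.
    rcases (add_nonneg ha hb).eq_or_lt with hab | hab
    · obtain rfl : a = 0 := by linarith
      obtain rfl : b = 0 := by linarith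
      refine ⟨0, le_rfl, σ, hσ, hσJ, ?_, ?_⟩
      · convert hXσ.add hYτ using 1
        simp only [Prod.fst_add, conjTranspose_add]
        module
      · simp only [Prod.snd_add] at *
        linarith
    · have ha' : 0 ≤ a / (a + b) := by positivity
      have hb' : 1 - a / (a + b) = b / (a + b) := by field_simp; ring
      have hb'' : 0 ≤ b / (a + b) := by positivity
      refine ⟨a + b, hab.le, (a / (a + b)) • σ + (1 - a / (a + b)) • τ,
        (isHermitian_real_smul hσ _).add (isHermitian_real_smul hτ _),
        spectrum_convexCombination_subset hJ hσ hτ hσJ hτJ ha' (hb' ▸ hb'') (by ring), ?_, ?_⟩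
      · convert hXσ.add hYτ using 1
        have e1 : (2 * (a + b)) * (a / (a + b)) = 2 * a := by field_simp
        have e2 : (2 * (a + b)) * (b / (a + b)) = 2 * b := by field_simp
        rw [hb', smul_add, smul_smul, smul_smul, e1, e2]
        simp only [Prod.fst_add, conjTranspose_add]
        module
      · have h1 := re_trace_mul_nonneg hP
          (hG.posSemidef_sub hσ hτ hσJ hτJ ha' (by rw [← sub_nonneg, hb']; exact hb''))
        rw [Matrix.mul_sub, Matrix.mul_add, Matrix.mul_smul, Matrix.mul_smul, trace_sub,
          trace_add, trace_smul, trace_smul, Complex.sub_re, Complex.add_re, Complex.smul_re,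
          Complex.smul_re, smul_eq_mul, smul_eq_mul, sub_nonneg] at h1
        have h2 := mul_le_mul_of_nonneg_left h1 hab.le
        have e1 : (a + b) * (a / (a + b) * (P * cfc G σ).trace.re +
            (1 - a / (a + b)) * (P * cfc G τ).trace.re) =
            a * (P * cfc G σ).trace.re + b * (P * cfc G τ).trace.re := by
          rw [hb']; field_simp
        rw [e1] at h2
        simp only [Prod.snd_add] at *
        linarith
  zero_mem' := by
    obtain ⟨m, hm⟩ := hJne
    refine ⟨0, le_rfl, diagonal fun _ => (m : ℂ), isHermitian_diagonal_ofReal _, ?_, ?_, ?_⟩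
    · rw [spectrum_diagonal_ofReal]
      rintro _ ⟨_, rfl⟩
      exact hm
    · simpa using PosSemidef.zero
    · simp
  smul_mem' := by
    rintro ⟨c, hc⟩ ⟨X, r⟩ ⟨a, ha, σ, hσ, hσJ, hXσ, hr⟩
    refine ⟨c * a, mul_nonneg hc ha, σ, hσ, hσJ, ?_, ?_⟩
    · convert posSemidef_real_smul hXσ hc using 1
      change c • X + (c • X)ᴴ - _ = _
      rw [conjTranspose_smul, star_trivial]
      module
    · change _ ≤ c * r
      rw [mul_assoc]
      exact mul_le_mul_of_nonneg_left hr hc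

/-- The real-linear functional `X ↦ Re tr[N X]`. -/
def reTraceMul (N : Matrix n n ℂ) : Matrix n n ℂ →ₗ[ℝ] ℝ where
  toFun X := (N * X).trace.re
  map_add' X Y := by rw [Matrix.mul_add, trace_add, Complex.add_re]
  map_smul' c X := by rw [Matrix.mul_smul, trace_smul, Complex.smul_re, RingHom.id_apply]

/-- Multiples of the identity dominate; this gives the cofinality hypothesis of `riesz_extension`.
-/
theorem exists_posSemidef_add_smul_one {X : Matrix n n ℂ} (hX : X.IsHermitian) :
    ∃ c : ℝ, (c • (1 : Matrix n n ℂ) + X).PosSemidef := by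
  obtain ⟨M, d, hM, -, hg⟩ := exists_spectral_povm hX
  obtain ⟨c, hc⟩ := (Set.finite_range fun i => -d i).bddAbove
  refine ⟨c, ?_⟩
  have h1 := hg fun x => x
  rw [cfc_id_real hX] at h1
  rw [← hM.2, h1, Finset.smul_sum, ← Finset.sum_add_distrib]
  refine posSemidef_sum _ fun i _ => ?_
  rw [← add_smul]
  refine posSemidef_real_smul (hM.1 i) ?_
  have := hc ⟨i, rfl⟩
  linarith

variable {A R : Type*} [Fintype A] [DecidableEq A] [Fintype R] [DecidableEq R] [Nonempty R]

theorem exists_extension_variational_le (hJ : Convex ℝ J) (hJb : ¬ BddAbove J)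
    (hmono : OperatorMonotoneOn J G) (hG : OperatorConcaveOn J G)
    {P : Matrix (A × R) (A × R) ℂ} (hP : P.PosSemidef) {N : Matrix A A ℂ} (hN : N.PosSemidef)
    {V : ℝ} (hV : ∀ τ : Matrix A A ℂ, τ.IsHermitian → spectrum ℝ τ ⊆ J →
      (partialTraceR P * cfc G τ).trace.re - (N * τ).trace.re ≤ V) :
    ∃ K ∈ extensions R N, ∀ τ : Matrix (A × R) (A × R) ℂ, τ.IsHermitian → spectrum ℝ τ ⊆ J →
      (P * cfc G τ).trace.re - (K * τ).trace.re ≤ V := by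
  have hJne : J.Nonempty := by
    by_contra h
    rw [Set.not_nonempty_iff_eq_empty] at h
    exact hJb (h ▸ bddAbove_empty)
  obtain ⟨m, hm⟩ := hJne
  obtain ⟨r₀⟩ := ‹Nonempty R›
  have : Nonempty R := ⟨r₀⟩
  let C := variationalCone hJ ⟨m, hm⟩ hG hP V
  -- An arbitrary extension of `N`; on the subspace `S` only its marginal `N` matters.
  let K₀ : Matrix (A × R) (A × R) ℂ := N ⊗ₖ (single r₀ r₀ 1 : Matrix R R ℂ)
  let F : Matrix (A × R) (A × R) ℂ × ℝ →ₗ[ℝ] ℝ :=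
    (reTraceMul K₀).comp (LinearMap.fst ℝ _ _) + LinearMap.snd ℝ _ _
  have hF : ∀ Z : Matrix A A ℂ, ∀ r : ℝ, F (Z ⊗ₖ (1 : Matrix R R ℂ), r) =
      (N * Z).trace.re + r := by
    intro Z r
    change (K₀ * (Z ⊗ₖ (1 : Matrix R R ℂ))).trace.re + r = _
    rw [trace_mul_kronecker_one, partialTraceR_kronecker_single]
  let S : Submodule ℝ (Matrix (A × R) (A × R) ℂ × ℝ) :=
    { carrier := {p | ∃ Z : Matrix A A ℂ, p.1 = Z ⊗ₖ (1 : Matrix R R ℂ)}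
      add_mem' := by
        rintro p q ⟨Z, hZ⟩ ⟨Z', hZ'⟩
        exact ⟨Z + Z', by rw [Prod.fst_add, hZ, hZ', add_kronecker]⟩
      zero_mem' := ⟨0, by simp⟩
      smul_mem' := by
        rintro c p ⟨Z, hZ⟩
        exact ⟨c • Z, by rw [Prod.smul_fst, hZ, smul_kronecker]⟩ }
  have hdiag : ∀ m ∈ J, spectrum ℝ (diagonal fun _ : A × R => (m : ℂ)) ⊆ J := by
    intro m hm
    rw [spectrum_diagonal_ofReal]
    rintro _ ⟨_, rfl⟩
    exact hm
  have hC0 : ∀ X : Matrix (A × R) (A × R) ℂ, ∀ r : ℝ, 0 ≤ r → (X + Xᴴ).PosSemidef →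
      (X, r) ∈ C := by
    intro X r hr hX
    exact ⟨0, le_rfl, _, isHermitian_diagonal_ofReal _, hdiag m hm, by simpa using hX,
      by simpa using hr⟩
  obtain ⟨g, hgF, hgC⟩ := riesz_extension C ⟨S, F.comp S.subtype⟩ (by
    rintro ⟨⟨X, r⟩, Z, hZ : X = _⟩ ⟨t, ht, τ, hτ, hτJ, hXτ, hr⟩
    subst hZ
    change 0 ≤ F (Z ⊗ₖ (1 : Matrix R R ℂ), r)
    rw [hF]
    set H := (1 / 2 : ℝ) • (Z + Zᴴ) with hHdef
    have hH : H.IsHermitian := isHermitian_real_smul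
      (by rw [IsHermitian, conjTranspose_add, conjTranspose_conjTranspose, add_comm]) _
    have hNH : (N * Z).trace.re = (N * H).trace.re := by
      have := re_trace_conjTranspose_mul N Z
      rw [hN.1.eq] at this
      rw [hHdef, Matrix.mul_smul, trace_smul, Complex.smul_re, Matrix.mul_add, trace_add,
        Complex.add_re, ← this, smul_eq_mul]
      ring
    have hsum : Z ⊗ₖ (1 : Matrix R R ℂ) + (Z ⊗ₖ (1 : Matrix R R ℂ))ᴴ =
        (2 : ℝ) • (H ⊗ₖ (1 : Matrix R R ℂ)) := by
      rw [conjTranspose_kronecker, conjTranspose_one, ← add_kronecker, ← smul_kronecker, hHdef,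
        smul_smul]
      norm_num
    simp only [hsum] at hXτ
    rw [hNH]
    -- For `t = 0` the Hermitian part of `Z` is positive. For `t > 0`, rescaling gives `τ ≤ η ⊗ 1`,
    -- to which monotonicity of `G` and the bound `hV` apply.
    rcases ht.eq_or_lt with rfl | ht
    · have h1 := posSemidef_real_smul hXτ (c := 1 / 2) (by norm_num)
      rw [mul_zero, zero_smul, sub_zero, smul_smul] at h1
      norm_num at h1
      have h2 := re_trace_mul_nonneg hN (posSemidef_of_kronecker_one h1)
      have h3 : 0 ≤ r := by simpa using hr
      linarith
    · have h1 := posSemidef_real_smul hXτ (c := (2 * t)⁻¹) (by positivity)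
      have e1 : (2 * t)⁻¹ • ((2 : ℝ) • (H ⊗ₖ (1 : Matrix R R ℂ)) - (2 * t) • τ) =
          (t⁻¹ • H) ⊗ₖ (1 : Matrix R R ℂ) - τ := by
        have e2 : (2 * t)⁻¹ * 2 = t⁻¹ := by field_simp
        rw [smul_sub, smul_smul, smul_smul, smul_kronecker t⁻¹ H, inv_mul_cancel₀ (by positivity),
          one_smul, e2]
      rw [e1] at h1
      set η := t⁻¹ • H with hη
      have hηH : η.IsHermitian := isHermitian_real_smul hH _
      obtain ⟨hη1, hη1J⟩ := spectrum_subset_of_posSemidef_sub hJ hJb hτ hτJ h1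
      have hηJ : spectrum ℝ η ⊆ J := by
        refine (spectrum_subset_iff hηH hJ).2 fun v hv => ?_
        -- The vector `v ⊗ e_{r₀}` recovers the numerical range of `η` from that of `η ⊗ 1`.
        let w : A × R → ℂ := fun p => if p.2 = r₀ then v p.1 else 0
        have hw : star w ⬝ᵥ w = 1 := by
          rw [← hv]
          simp [dotProduct, Fintype.sum_prod_type, w]
        have := (spectrum_subset_iff hη1 hJ).1 hη1J w hw
        convert this using 2
        simp [dotProduct, Fintype.sum_prod_type, w, Matrix.mulVec, Matrix.one_apply]
      have h2 := hV η hηH hηJ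
      have h3 := re_trace_mul_nonneg hP (hmono.posSemidef_sub hτ hη1 hτJ hη1J h1)
      rw [Matrix.mul_sub, trace_sub, Complex.sub_re, cfc_kronecker_one G hηH,
        trace_mul_kronecker_one] at h3
      have h4 : (N * η).trace.re = t⁻¹ * (N * H).trace.re := by
        rw [hη, Matrix.mul_smul, trace_smul, Complex.smul_re, smul_eq_mul]
      have h5 : t * (N * η).trace.re = (N * H).trace.re := by
        rw [h4]; field_simp
      have h6 : t * -(N * η).trace.re ≤ t * (V - (P * cfc G τ).trace.re) :=
        mul_le_mul_of_nonneg_left (by linarith) ht.le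
      change t * _ ≤ r at hr
      linarith) (by
    rintro ⟨Y, s⟩
    obtain ⟨c, hc⟩ := exists_posSemidef_add_smul_one (X := Y + Yᴴ)
      (by rw [IsHermitian, conjTranspose_add, conjTranspose_conjTranspose, add_comm])
    refine ⟨⟨(((c / 2) • (1 : Matrix A A ℂ)) ⊗ₖ (1 : Matrix R R ℂ), -s), _, rfl⟩, ?_⟩
    refine hC0 _ _ (by simp) ?_
    convert hc using 1
    change ((c / 2) • (1 : Matrix A A ℂ)) ⊗ₖ (1 : Matrix R R ℂ) + Y +
      (((c / 2) • (1 : Matrix A A ℂ)) ⊗ₖ (1 : Matrix R R ℂ) + Y)ᴴ = _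
    rw [smul_kronecker, one_kronecker_one, conjTranspose_add, conjTranspose_smul,
      conjTranspose_one, star_trivial]
    module)
  have hgS : ∀ Z : Matrix A A ℂ, ∀ r : ℝ, g (Z ⊗ₖ (1 : Matrix R R ℂ), r) =
      (N * Z).trace.re + r := fun Z r => (hgF ⟨(_, r), Z, rfl⟩).trans (hF Z r)
  obtain ⟨K, hK⟩ := exists_re_trace_mul_eq (g.comp (LinearMap.inl ℝ _ _))
  have hK : ∀ X, g (X, 0) = (K * X).trace.re := hK
  have hg1 : g (0, 1) = 1 := by simpa using hgS 0 1
  have hgK : ∀ X r, g (X, r) = (K * X).trace.re + r := by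
    intro X r
    have : (X, r) = (X, 0) + r • ((0, 1) : Matrix (A × R) (A × R) ℂ × ℝ) := by simp
    rw [this, map_add, map_smul, hg1, hK, smul_eq_mul, mul_one]
  have hKpos : K.PosSemidef := by
    refine posSemidef_of_re_trace_mul_nonneg (fun X => ?_) fun X hX => ?_
    · have h1 := hgC _ (hC0 (X - Xᴴ) 0 le_rfl (by simpa using PosSemidef.zero))
      have h2 := hgC _ (hC0 (Xᴴ - X) 0 le_rfl (by simpa using PosSemidef.zero))
      rw [hK, Matrix.mul_sub, trace_sub, Complex.sub_re] at h1 h2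
      linarith
    · have := hgC _ (hC0 X 0 le_rfl (by rw [hX.1.eq]; exact hX.add hX))
      rwa [hK] at this
  refine ⟨K, ⟨hKpos, eq_of_re_trace_mul fun Z => ?_⟩, fun τ hτ hτJ => ?_⟩
  · rw [← trace_mul_kronecker_one, ← hK, hgS, add_zero]
  · have := hgC (τ, V - (P * cfc G τ).trace.re) ⟨1, zero_le_one, τ, hτ, hτJ, by
      rw [hτ.eq, mul_one, two_smul, sub_self]
      exact PosSemidef.zero, by rw [one_mul]⟩
    rw [hgK] at this
    linarith

end Extension

/-! ### From the variational bound to measured quantities. -/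

section Uhlmann

variable {A R : Type*} [Fintype A] [DecidableEq A] [Fintype R] [DecidableEq R]

theorem outcome_nonneg {Y : Type*} [Fintype Y] {ρ : Matrix A A ℂ} (hρ : ρ.PosSemidef)
    {M : Y → Matrix A A ℂ} (hM : IsPOVM M) (y : Y) : 0 ≤ outcome ρ M y :=
  re_trace_mul_nonneg hρ (hM.1 y)

omit [DecidableEq A] in
theorem sum_mul_outcome {Y : Type*} [Fintype Y] (ρ : Matrix A A ℂ) (M : Y → Matrix A A ℂ)
    (z : Y → ℝ) : ∑ y, z y * outcome ρ M y = (ρ * ∑ y, z y • M y).trace.re := by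
  rw [Matrix.mul_sum, trace_sum, Complex.re_sum]
  refine Finset.sum_congr rfl fun y _ => ?_
  rw [Matrix.mul_smul, trace_smul, Complex.smul_re, smul_eq_mul, outcome]

omit [Fintype A] [DecidableEq A] [DecidableEq R] in
theorem partialTraceR_posSemidef {P : Matrix (A × R) (A × R) ℂ} (hP : P.PosSemidef) :
    (partialTraceR P).PosSemidef := by
  have : partialTraceR P = ∑ r, P.submatrix (fun a => (a, r)) fun a => (a, r) := by
    ext a b
    simp [partialTraceR, Matrix.sum_apply]
  rw [this]
  exact posSemidef_sum _ fun r _ => hP.submatrix _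

theorem coe_finset_sum {Y : Type*} (s : Finset Y) (b : Y → ℝ) :
    ((∑ y ∈ s, b y : ℝ) : EReal) = ∑ y ∈ s, (b y : EReal) :=
  map_sum (⟨⟨Real.toEReal, EReal.coe_zero⟩, EReal.coe_add⟩ : ℝ →+ EReal) b s

/-- Replaces suprema that may be infinite or not attained by real lower bounds, one for each
outcome. -/
theorem sum_le_of_forall_coe_lt {Y : Type*} (s : Finset Y) {a : Y → EReal} {c : EReal}
    (h : ∀ b : Y → ℝ, (∀ y, (b y : EReal) < a y) → ((∑ y ∈ s, b y : ℝ) : EReal) ≤ c)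
    (hbot : ∀ y, a y ≠ ⊥) : ∑ y ∈ s, a y ≤ c := by
  classical
  induction s using Finset.induction_on generalizing c with
  | empty =>
    choose b hb using fun y => EReal.lt_iff_exists_real_btwn.1 (bot_lt_iff_ne_bot.2 (hbot y))
    simpa using h b fun y => (hb y).2
  | insert i s hi ih =>
    rw [Finset.sum_insert hi]
    refine EReal.add_le_of_forall_lt fun u hu w hw => ?_
    obtain ⟨u', hu', hu''⟩ := EReal.lt_iff_exists_real_btwn.1 hu
    refine (add_le_add hu'.le hw.le).trans ?_
    rw [add_comm]
    refine EReal.add_le_of_le_sub (ih fun b hb => ?_)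
    refine EReal.le_sub_iff_add_le (Or.inl (EReal.coe_ne_bot _)) (Or.inl (EReal.coe_ne_top _)) |>.2 ?_
    have := h (Function.update b i u') fun y => by
      rcases eq_or_ne y i with rfl | hy
      · simpa using hu''
      · simpa [hy] using hb y
    rw [Finset.sum_insert hi, Function.update_self, Finset.sum_update_of_notMem hi] at this
    rw [add_comm]
    exact_mod_cast this

variable {J : Set ℝ} {G : ℝ → ℝ} {T : ℝ → ℝ → EReal}

/-- Uhlmann's theorem for measured quantities whose classical version `∑ T(pₓ, qₓ)` has the
variational expression `T(p, q) = sup_{z ∈ J} (p G(z) - q z)`. -/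
theorem exists_extension_measured_le [Nonempty R] (hJ : Convex ℝ J) (hJb : ¬ BddAbove J)
    (hmono : OperatorMonotoneOn J G) (hG : OperatorConcaveOn J G)
    (hle : ∀ p q, 0 ≤ p → 0 ≤ q → ∀ z ∈ J, ((p * G z - q * z : ℝ) : EReal) ≤ T p q)
    (hex : ∀ p q, 0 ≤ p → 0 ≤ q → ∀ b : ℝ, (b : EReal) < T p q → ∃ z ∈ J, b ≤ p * G z - q * z)
    {P : Matrix (A × R) (A × R) ℂ} (hP : P.PosSemidef) {N : Matrix A A ℂ} (hN : N.PosSemidef) :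
    ∃ K ∈ extensions R N, ∀ (n : ℕ) (M : Fin n → Matrix (A × R) (A × R) ℂ), IsPOVM M →
      ∑ x, T (outcome P M x) (outcome K M x) ≤
        ⨆ (n : ℕ) (M : Fin n → Matrix A A ℂ) (_ : IsPOVM M),
          ∑ x, T (outcome (partialTraceR P) M x) (outcome N M x) := by
  set V := ⨆ (n : ℕ) (M : Fin n → Matrix A A ℂ) (_ : IsPOVM M),
    ∑ x, T (outcome (partialTraceR P) M x) (outcome N M x) with hVdef
  have hPA := partialTraceR_posSemidef hP
  have hJne : J.Nonempty := by
    by_contra h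
    rw [Set.not_nonempty_iff_eq_empty] at h
    exact hJb (h ▸ bddAbove_empty)
  have hV : ∀ τ : Matrix A A ℂ, τ.IsHermitian → spectrum ℝ τ ⊆ J →
      (((partialTraceR P * cfc G τ).trace.re - (N * τ).trace.re : ℝ) : EReal) ≤ V := by
    intro τ hτ hτJ
    obtain ⟨M, d, hM, hd, hg⟩ := exists_spectral_povm hτ
    let e := (Fintype.equivFin A).symm
    have hM' : IsPOVM fun x => M (e x) := ⟨fun x => hM.1 _, by rw [e.sum_comp M, hM.2]⟩
    have h1 : (partialTraceR P * cfc G τ).trace.re - (N * τ).trace.re =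
        ∑ x, (outcome (partialTraceR P) (fun x => M (e x)) x * G (d (e x)) -
          outcome N (fun x => M (e x)) x * d (e x)) := by
      have h2 := hg fun x => x
      rw [cfc_id_real hτ] at h2
      rw [hg G, h2, ← sum_mul_outcome, ← sum_mul_outcome, Finset.sum_sub_distrib, ← e.sum_comp,
        ← e.sum_comp]
      simp only [mul_comm, outcome]
    rw [h1, coe_finset_sum]
    refine le_iSup_of_le (Fintype.card A) (le_iSup_of_le (fun x => M (e x))
      (le_iSup_of_le hM' (Finset.sum_le_sum fun x _ => ?_)))
    exact hle _ _ (outcome_nonneg hPA hM' x) (outcome_nonneg hN hM' x) _ (hτJ (hd _))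
  rcases eq_or_ne V ⊤ with hVt | hVt
  · obtain ⟨r⟩ := ‹Nonempty R›
    exact ⟨_, extensions_kronecker_single hN r, fun n M hM => by rw [hVt]; exact le_top⟩
  have hVb : V ≠ ⊥ := by
    obtain ⟨m, hm⟩ := hJne
    have := hV (diagonal fun _ => (m : ℂ)) (isHermitian_diagonal_ofReal _) (by
      rw [spectrum_diagonal_ofReal]
      rintro _ ⟨_, rfl⟩
      exact hm)
    exact ((EReal.bot_lt_coe _).trans_le this).ne'
  lift V to ℝ using ⟨hVt, hVb⟩ with V' hV'
  obtain ⟨K, hK, hKV⟩ := exists_extension_variational_le hJ hJb hmono hG hP hN (V := V')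
    fun τ hτ hτJ => by exact_mod_cast hV τ hτ hτJ
  refine ⟨K, hK, fun n M hM => sum_le_of_forall_coe_lt _ (fun b hb => ?_) fun x => ?_⟩
  -- Near-optimal `z x` for the separate outcomes combine into the one operator `τ = ∑ z x • M x`;
  -- Jensen compares `∑ G(z x) • M x` with `G(τ)`.
  · choose z hz hbz using fun x => hex _ _ (outcome_nonneg hP hM x) (outcome_nonneg hK.1 hM x) _ (hb x)
    have h1 := re_trace_mul_nonneg hP (hG.jensen hM hz)
    have hτ : (∑ x, z x • M x).IsHermitian := by
      rw [IsHermitian, conjTranspose_sum]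
      exact Finset.sum_congr rfl fun x _ => isHermitian_real_smul (hM.1 x).1 _
    have h2 := hKV _ hτ ((spectrum_subset_iff hτ hJ).2 fun v hv => povm_re_mem hJ hM hz hv)
    rw [Matrix.mul_sub, trace_sub, Complex.sub_re, ← sum_mul_outcome] at h1
    rw [← sum_mul_outcome] at h2
    have h3 : ∑ x, b x ≤ ∑ x, (G (z x) * outcome P M x - z x * outcome K M x) :=
      Finset.sum_le_sum fun x _ => by linarith [hbz x]
    rw [Finset.sum_sub_distrib] at h3
    exact_mod_cast (by linarith : ∑ x, b x ≤ V')
  · obtain ⟨m, hm⟩ := hJne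
    exact ((EReal.bot_lt_coe _).trans_le
      (hle _ _ (outcome_nonneg hP hM x) (outcome_nonneg hK.1 hM x) m hm)).ne'

end Uhlmann

end MeasuredDivergence

namespace MeasuredDivergence

/-! ### Fenchel duality for the summand `q f(p/q)`. -/

section Conjugate

variable {f : ℝ → EReal}

theorem IsDivergenceFunction.coe_toReal (hf : IsDivergenceFunction f) {t : ℝ} (ht : t ∈ effDom f) :
    ((f t).toReal : EReal) = f t :=
  EReal.coe_toReal (ne_of_lt ht) (hf.ne_bot t)

theorem IsDivergenceFunction.convexOn_toReal (hf : IsDivergenceFunction f) :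
    ConvexOn ℝ (effDom f) fun t => (f t).toReal := by
  have h : ∀ x ∈ effDom f, ∀ y ∈ effDom f, ∀ a b : ℝ, 0 ≤ a → 0 ≤ b → a + b = 1 →
      f (a • x + b • y) ≤ ((a • (f x).toReal + b • (f y).toReal : ℝ) : EReal) := by
    intro x hx y hy a b ha hb hab
    exact hf.convex (x := (x, (f x).toReal)) (hf.coe_toReal hx).ge
      (y := (y, (f y).toReal)) (hf.coe_toReal hy).ge ha hb hab
  have hD : Convex ℝ (effDom f) := fun x hx y hy a b ha hb hab =>
    (h x hx y hy a b ha hb hab).trans_lt (EReal.coe_lt_top _)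
  refine ⟨hD, fun x hx y hy a b ha hb hab => ?_⟩
  have h1 := h x hx y hy a b ha hb hab
  rw [← hf.coe_toReal (hD hx hy ha hb hab)] at h1
  exact_mod_cast h1

theorem IsDivergenceFunction.fenchelConj_le_iff (hf : IsDivergenceFunction f) {z c : ℝ} :
    fenchelConj f z ≤ c ↔ ∀ t ∈ effDom f, t * z - (f t).toReal ≤ c := by
  rw [fenchelConj, iSup₂_le_iff]
  refine forall₂_congr fun t ht => ?_
  rw [← hf.coe_toReal ht, EReal.toReal_coe, ← EReal.coe_sub, EReal.coe_le_coe_iff]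

theorem IsDivergenceFunction.fenchelConj_ne_bot (hf : IsDivergenceFunction f) (z : ℝ) :
    fenchelConj f z ≠ ⊥ := by
  have h1 : (1 : ℝ) ∈ effDom f := hf.pos_subset_dom (Set.mem_Ioi.2 one_pos)
  intro h
  have h2 : fenchelConj f z ≤ ((1 * z - (f 1).toReal - 1 : ℝ) : EReal) := h ▸ bot_le
  have := hf.fenchelConj_le_iff.1 h2 1 h1
  linarith

theorem IsDivergenceFunction.coe_conjReal (hf : IsDivergenceFunction f) {z : ℝ}
    (hz : z ∈ conjDom f) : (conjReal f z : EReal) = fenchelConj f z :=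
  EReal.coe_toReal (ne_of_lt hz) (hf.fenchelConj_ne_bot z)

theorem IsDivergenceFunction.conjReal_le_iff (hf : IsDivergenceFunction f) {z c : ℝ}
    (hz : z ∈ conjDom f) :
    conjReal f z ≤ c ↔ ∀ t ∈ effDom f, t * z - (f t).toReal ≤ c := by
  rw [← hf.fenchelConj_le_iff, ← hf.coe_conjReal hz, EReal.coe_le_coe_iff]

theorem IsDivergenceFunction.mul_sub_le_conjReal (hf : IsDivergenceFunction f) {z t : ℝ}
    (hz : z ∈ conjDom f) (ht : t ∈ effDom f) : t * z - (f t).toReal ≤ conjReal f z :=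
  (hf.conjReal_le_iff hz).1 le_rfl t ht

theorem IsDivergenceFunction.mem_conjDom (hf : IsDivergenceFunction f) {z c : ℝ}
    (h : ∀ t ∈ effDom f, t * z - (f t).toReal ≤ c) : z ∈ conjDom f :=
  (hf.fenchelConj_le_iff.2 h).trans_lt (EReal.coe_lt_top c)

theorem IsDivergenceFunction.convexOn_conjReal (hf : IsDivergenceFunction f) :
    ConvexOn ℝ (conjDom f) (conjReal f) := by
  have h : ∀ x ∈ conjDom f, ∀ y ∈ conjDom f, ∀ a b : ℝ, 0 ≤ a → 0 ≤ b → a + b = 1 →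
      ∀ t ∈ effDom f, t * (a • x + b • y) - (f t).toReal ≤
        a • conjReal f x + b • conjReal f y := by
    intro x hx y hy a b ha hb hab t ht
    have h1 := mul_le_mul_of_nonneg_left (hf.mul_sub_le_conjReal hx ht) ha
    have h2 := mul_le_mul_of_nonneg_left (hf.mul_sub_le_conjReal hy ht) hb
    have h3 : (a + b) * (f t).toReal = (f t).toReal := by rw [hab, one_mul]
    simp only [smul_eq_mul]
    linarith
  exact ⟨fun x hx y hy a b ha hb hab => hf.mem_conjDom (h x hx y hy a b ha hb hab),
    fun x hx y hy a b ha hb hab =>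
      (hf.conjReal_le_iff (hf.mem_conjDom (h x hx y hy a b ha hb hab))).2
        (h x hx y hy a b ha hb hab)⟩

/-- A convex lower semicontinuous function takes all intermediate values. -/
theorem IsDivergenceFunction.convex_conjRange (hf : IsDivergenceFunction f) :
    Convex ℝ (conjRange f) := by
  rw [convex_iff_ordConnected]
  refine ⟨?_⟩
  rintro _ ⟨a, ha, rfl⟩ _ ⟨b, hb, rfl⟩ c ⟨hac, hcb⟩
  have hφ := hf.convexOn_conjReal
  let p : ℝ → ℝ := fun s => (1 - s) • a + s • b
  have hp : Continuous p := by simp only [p, smul_eq_mul]; fun_prop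
  -- The part of the segment where `f* ≤ c`, closed because `f*` is a supremum of affine functions.
  -- At its last point `f* = c`: if `f* < c` there, convexity would allow a further step towards
  -- `b`.
  let S : Set ℝ := Set.Icc 0 1 ∩ {s | ∀ t ∈ effDom f, t * p s - (f t).toReal ≤ c}
  have hSc : IsCompact S := by
    refine isCompact_Icc.inter_right ?_
    simp only [Set.ofPred_forall]
    exact isClosed_iInter fun t => isClosed_iInter fun _ =>
      isClosed_le (by fun_prop) continuous_const
  have hS0 : (0 : ℝ) ∈ S :=
    ⟨⟨le_rfl, zero_le_one⟩, (by simpa [p] using (hf.conjReal_le_iff ha).1 hac)⟩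
  obtain ⟨s, ⟨⟨hs0, hs1⟩, hs⟩, hmax⟩ := hSc.exists_isMaxOn ⟨0, hS0⟩ continuousOn_id
  have hps := hf.mem_conjDom hs
  have hpsc := (hf.conjReal_le_iff hps).2 hs
  refine ⟨p s, hps, hpsc.antisymm ?_⟩
  by_contra hlt
  push Not at hlt
  have hs1' : s < 1 := by
    refine lt_of_le_of_ne hs1 ?_
    rintro rfl
    simp only [p, sub_self, zero_smul, one_smul, zero_add] at hlt
    exact absurd hcb hlt.not_ge
  have hcont : Tendsto (fun e : ℝ => (1 - e) * conjReal f (p s) + e * conjReal f b) (𝓝[>] 0)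
      (𝓝 ((1 - 0) * conjReal f (p s) + 0 * conjReal f b)) :=
    (Continuous.tendsto (by fun_prop) 0).mono_left nhdsWithin_le_nhds
  have hev := hcont.eventually_lt_const (u := c) (by simpa using hlt)
  have hev' : ∀ᶠ e : ℝ in 𝓝[>] 0, e ∈ Set.Ioo (0 : ℝ) 1 := Ioo_mem_nhdsGT one_pos
  obtain ⟨e, he, he0, he1⟩ := (hev.and hev').exists
  have hpe : p (s + e * (1 - s)) = (1 - e) • p s + e • b := by
    simp only [p, smul_eq_mul]; ring
  have hmem := hφ.1 hps hb (sub_nonneg.2 he1.le) he0.le (by ring)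
  have hval := (hφ.2 hps hb (sub_nonneg.2 he1.le) he0.le (by ring)).trans he.le
  have hin : s + e * (1 - s) ∈ S := by
    refine ⟨⟨by nlinarith, by nlinarith⟩, ?_⟩
    change ∀ t ∈ effDom f, t * p (s + e * (1 - s)) - _ ≤ c
    rw [hpe]
    exact (hf.conjReal_le_iff hmem).1 hval
  have := hmax hin
  simp only [id_eq] at this
  have : 0 < e * (1 - s) := mul_pos he0 (sub_pos.2 hs1')
  simp only [Set.mem_ofPred_eq] at *
  linarith

/-- The right derivative at an interior point is the slope of a supporting line. -/
theorem IsDivergenceFunction.exists_subgradient (hf : IsDivergenceFunction f) {t₀ : ℝ}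
    (ht₀ : 0 < t₀) : ∃ z ∈ conjDom f, t₀ * z - conjReal f z = (f t₀).toReal := by
  have hc := hf.convexOn_toReal
  have hint : t₀ ∈ interior (effDom f) :=
    interior_maximal hf.pos_subset_dom isOpen_Ioi ht₀
  set F := fun t => (f t).toReal with hF
  set z := derivWithin F (Set.Ioi t₀) t₀ with hz
  have hle : ∀ t ∈ effDom f, t * z - (f t).toReal ≤ t₀ * z - (f t₀).toReal := by
    intro t ht
    change t * z - F t ≤ t₀ * z - F t₀
    rcases lt_trichotomy t t₀ with h | rfl | h
    · have h1 := (hc.slope_le_leftDeriv_of_mem_interior ht hint h).trans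
        (hc.leftDeriv_le_rightDeriv_of_mem_interior hint)
      rw [slope_def_field, div_le_iff₀ (sub_pos.2 h)] at h1
      linarith
    · exact le_rfl
    · have h1 := hc.rightDeriv_le_slope_of_mem_interior hint ht h
      rw [slope_def_field, le_div_iff₀ (sub_pos.2 h)] at h1
      linarith
  have hzD := hf.mem_conjDom hle
  refine ⟨z, hzD, le_antisymm ?_ ?_⟩
  · linarith [hf.mul_sub_le_conjReal hzD (interior_subset hint)]
  · linarith [(hf.conjReal_le_iff hzD).2 hle]

/-- A function which is sandwiched near `0` between the affine functions `a z + t c z` from below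
and convex combinations of the values `a z` with a constant from above tends to `⨆ z, a z`. -/
theorem tendsto_iSup_of_affine_bounds {D : Set ℝ} {a c : ℝ → ℝ} {u : ℝ → ℝ} {k C : ℝ}
    (hlow : ∀ z ∈ D, ∀ t, 0 < t → a z + t * c z ≤ u t)
    (hupp : ∀ t, 0 < t → ∃ z ∈ D, u t ≤ (1 - k * t) * a z + t * C) :
    Tendsto (fun t => (u t : EReal)) (𝓝[>] 0) (𝓝 (⨆ z ∈ D, (a z : EReal))) := by
  have hcts : ∀ x y : ℝ, Tendsto (fun t : ℝ => x + t * y) (𝓝[>] 0) (𝓝 x) := by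
    intro x y
    have : Tendsto (fun t : ℝ => x + t * y) (𝓝 0) (𝓝 (x + 0 * y)) :=
      Continuous.tendsto (by fun_prop) 0
    rw [zero_mul, add_zero] at this
    exact this.mono_left nhdsWithin_le_nhds
  have hpos : ∀ᶠ t : ℝ in 𝓝[>] 0, 0 < t := eventually_mem_nhdsWithin
  refine tendsto_order.2 ⟨fun b hb => ?_, fun b hb => ?_⟩
  · simp only [lt_iSup_iff] at hb
    obtain ⟨z, hz, hbz⟩ := hb
    obtain ⟨b', hb', hb''⟩ := EReal.lt_iff_exists_real_btwn.1 hbz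
    have h1 := (hcts (a z) (c z)).eventually_const_lt (EReal.coe_lt_coe_iff.1 hb'')
    filter_upwards [h1, hpos] with t ht ht0
    exact hb'.trans (EReal.coe_lt_coe_iff.2 (ht.trans_le (hlow z hz t ht0)))
  · obtain ⟨S, hS, hS'⟩ := EReal.lt_iff_exists_real_btwn.1 hb
    obtain ⟨B, hB, hB'⟩ := EReal.lt_iff_exists_real_btwn.1 hS'
    have hk : ∀ᶠ t : ℝ in 𝓝[>] 0, 0 < 1 + t * -k :=
      (hcts 1 (-k)).eventually_const_lt one_pos
    have h1 := (hcts S (C - k * S)).eventually_lt_const (EReal.coe_lt_coe_iff.1 hB)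
    filter_upwards [h1, hk, hpos] with t ht hkt ht0
    refine lt_trans (EReal.coe_lt_coe_iff.2 ?_) hB'
    obtain ⟨z, hz, hzu⟩ := hupp t ht0
    have haz : a z ≤ S := by
      have := (le_iSup₂ (f := fun z (_ : z ∈ D) => (a z : EReal)) z hz).trans hS.le
      exact EReal.coe_le_coe_iff.1 this
    have := mul_le_mul_of_nonneg_left haz hkt.le
    linarith

theorem IsDivergenceFunction.limUnder_zero (hf : IsDivergenceFunction f) :
    limUnder (𝓝[>] (0 : ℝ)) f = ⨆ z ∈ conjDom f, ((-conjReal f z : ℝ) : EReal) := by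
  -- With `z` a subgradient at `t`, `f(t) = t z - f*(z)`, and `z ≤ f(1) + f*(z)` gives `f(t) ≤ -(1 -
  -- t) f*(z) + t f(1)`.
  have h := tendsto_iSup_of_affine_bounds (D := conjDom f) (a := fun z => -conjReal f z)
    (c := fun z => z) (u := fun t => (f t).toReal) (k := 1) (C := (f 1).toReal)
    (fun z hz t ht => by linarith [hf.mul_sub_le_conjReal hz (hf.pos_subset_dom ht)])
    (fun t ht => by
      obtain ⟨z, hz, hzt⟩ := hf.exists_subgradient ht
      refine ⟨z, hz, ?_⟩
      have := mul_le_mul_of_nonneg_left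
        (hf.mul_sub_le_conjReal hz (hf.pos_subset_dom (Set.mem_Ioi.2 one_pos))) ht.le
      linarith)
  refine Tendsto.limUnder_eq (h.congr' ?_)
  filter_upwards [eventually_mem_nhdsWithin] with t ht
  exact hf.coe_toReal (hf.pos_subset_dom ht)

theorem IsDivergenceFunction.limUnder_perspective (hf : IsDivergenceFunction f) {p : ℝ}
    (hp : 0 < p) :
    limUnder (𝓝[>] (0 : ℝ)) (fun t : ℝ => (t : EReal) * f (p / t)) =
      ⨆ z ∈ conjDom f, ((p * z : ℝ) : EReal) := by
  -- With `z` a subgradient at `p/t`, `t f(p/t) = p z - t f*(z)`, and `-f*(z) ≤ f(1) - z` bounds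
  -- this by `(1 - t/p) p z + t f(1)`.
  have h := tendsto_iSup_of_affine_bounds (D := conjDom f) (a := fun z => p * z)
    (c := fun z => -conjReal f z) (u := fun t => t * (f (p / t)).toReal) (k := p⁻¹)
    (C := (f 1).toReal)
    (fun z hz t ht => by
      have := mul_le_mul_of_nonneg_left
        (hf.mul_sub_le_conjReal hz (hf.pos_subset_dom (div_pos hp ht))) ht.le
      have e : t * (p / t * z) = p * z := by field_simp
      rw [mul_sub, e] at this
      linarith)
    (fun t ht => by
      obtain ⟨z, hz, hzt⟩ := hf.exists_subgradient (div_pos hp ht)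
      refine ⟨z, hz, ?_⟩
      have := mul_le_mul_of_nonneg_left
        (hf.mul_sub_le_conjReal hz (hf.pos_subset_dom (Set.mem_Ioi.2 one_pos))) ht.le
      have e : t * (p / t * z) = p * z := by field_simp
      have e' : (1 - p⁻¹ * t) * (p * z) = p * z - t * z := by field_simp
      rw [← hzt, e', mul_sub, e]
      linarith)
  refine Tendsto.limUnder_eq (h.congr' ?_)
  filter_upwards [eventually_mem_nhdsWithin] with t ht
  rw [EReal.coe_mul, hf.coe_toReal (hf.pos_subset_dom (div_pos hp ht))]

theorem IsDivergenceFunction.conjDom_nonempty (hf : IsDivergenceFunction f) :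
    (conjDom f).Nonempty :=
  let ⟨z, hz, _⟩ := hf.exists_subgradient one_pos
  ⟨z, hz⟩

/-- The variational expression `q f(p / q) = sup_z (p z - q f*(z))`, including the boundary
conventions. -/
theorem IsDivergenceFunction.fTerm_eq_iSup (hf : IsDivergenceFunction f) {p q : ℝ} (hp : 0 ≤ p)
    (hq : 0 ≤ q) :
    fTerm f p q = ⨆ z ∈ conjDom f, ((p * z - q * conjReal f z : ℝ) : EReal) := by
  rcases hq.eq_or_lt with rfl | hq
  · rcases hp.eq_or_lt with rfl | hp
    · simp [fTerm, biSup_const hf.conjDom_nonempty]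
    · simp [fTerm, hp.ne', hf.limUnder_perspective hp]
  · rcases hp.eq_or_lt with rfl | hp
    · simp only [fTerm, hq.ne', if_false, if_true, hf.limUnder_zero, zero_mul, zero_sub]
      refine le_antisymm ?_ (iSup₂_le fun z hz => ?_)
      · rw [mul_comm, ← EReal.le_div_iff_mul_le (EReal.coe_pos.2 hq) (EReal.coe_ne_top q)]
        refine iSup₂_le fun z hz => ?_
        rw [EReal.le_div_iff_mul_le (EReal.coe_pos.2 hq) (EReal.coe_ne_top q)]
        refine le_trans (le_of_eq ?_)
          (le_iSup₂ (f := fun z (_ : z ∈ conjDom f) => ((-(q * conjReal f z) : ℝ) : EReal)) z hz)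
        rw [← EReal.coe_mul]
        congr 1
        ring
      · rw [← mul_neg, EReal.coe_mul]
        exact mul_le_mul_of_nonneg_left
          (le_iSup₂ (f := fun z (_ : z ∈ conjDom f) => ((-conjReal f z : ℝ) : EReal)) z hz)
          (EReal.coe_nonneg.2 hq.le)
    · have hpq := hf.pos_subset_dom (div_pos hp hq)
      have e : ∀ z, q * (p / q * z) = p * z := fun z => by field_simp
      simp only [fTerm, hq.ne', hp.ne', if_false]
      rw [← hf.coe_toReal hpq, ← EReal.coe_mul]
      refine le_antisymm ?_ (iSup₂_le fun z hz => EReal.coe_le_coe_iff.2 ?_)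
      · obtain ⟨z, hz, hzt⟩ := hf.exists_subgradient (div_pos hp hq)
        rw [← hzt, mul_sub, e]
        exact le_iSup₂ (f := fun z (_ : z ∈ conjDom f) =>
          ((p * z - q * conjReal f z : ℝ) : EReal)) z hz
      · have := mul_le_mul_of_nonneg_left (hf.mul_sub_le_conjReal hz hpq) hq.le
        rw [mul_sub, e] at this
        linarith

theorem IsDivergenceFunction.le_fTerm (hf : IsDivergenceFunction f) {p q z : ℝ} (hp : 0 ≤ p)
    (hq : 0 ≤ q) (hz : z ∈ conjDom f) :
    ((p * z - q * conjReal f z : ℝ) : EReal) ≤ fTerm f p q := by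
  rw [hf.fTerm_eq_iSup hp hq]
  exact le_iSup₂ (f := fun z (_ : z ∈ conjDom f) => ((p * z - q * conjReal f z : ℝ) : EReal)) z hz

theorem IsDivergenceFunction.exists_le_of_lt_fTerm (hf : IsDivergenceFunction f) {p q b : ℝ}
    (hp : 0 ≤ p) (hq : 0 ≤ q) (hb : (b : EReal) < fTerm f p q) :
    ∃ z ∈ conjDom f, b ≤ p * z - q * conjReal f z := by
  rw [hf.fTerm_eq_iSup hp hq] at hb
  simp only [lt_iSup_iff] at hb
  obtain ⟨z, hz, hbz⟩ := hb
  exact ⟨z, hz, (EReal.coe_lt_coe_iff.1 hbz).le⟩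

end Conjugate

/-! ### Data processing under the partial trace. -/

section DataProcessing

open Matrix
open scoped Kronecker

variable {A R : Type*} [Fintype A] [DecidableEq A] [Fintype R] [DecidableEq R]

/-- The measured divergence does not increase under the partial trace. -/
theorem measuredDiv_partialTraceR_le (f : ℝ → EReal) (ρ σ : Matrix (A × R) (A × R) ℂ) :
    measuredDiv f (partialTraceR ρ) (partialTraceR σ) ≤ measuredDiv f ρ σ := by
  refine iSup_le fun n => iSup_le fun M => iSup_le fun hM => ?_
  refine le_iSup_of_le n (le_iSup_of_le (fun x => M x ⊗ₖ (1 : Matrix R R ℂ))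
    (le_iSup_of_le ⟨fun x => (hM.1 x).kronecker PosSemidef.one, ?_⟩ (le_of_eq ?_)))
  · have : ∑ x, M x ⊗ₖ (1 : Matrix R R ℂ) = (∑ x, M x) ⊗ₖ (1 : Matrix R R ℂ) := by
      ext p q
      simp [Matrix.sum_apply, Finset.sum_mul]
    rw [this, hM.2, one_kronecker_one]
  · simp only [outcome, trace_mul_kronecker_one, fDiv]

end DataProcessing

end MeasuredDivergence

theorem theorem2 (f : ℝ → EReal) (hf : IsDivergenceFunction f)
    {A R : Type*} [Fintype A] [DecidableEq A] [Fintype R] [DecidableEq R] [Nonempty R] :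
    (OperatorConvexOn (conjDom f) (conjReal f) →
      OperatorMonotoneOn (conjDom f) (conjReal f) →
      ¬ BddBelow (conjDom f) →
      ∀ (ρA : Matrix A A ℂ) (σAR : Matrix (A × R) (A × R) ℂ),
        IsDensity ρA → σAR.PosSemidef →
        (⨅ ρAR ∈ extensions R ρA, measuredDiv f ρAR σAR)
            = measuredDiv f ρA (partialTraceR σAR) ∧
        ∃ ρAR ∈ extensions R ρA,
          measuredDiv f ρAR σAR = ⨅ τAR ∈ extensions R ρA, measuredDiv f τAR σAR) ∧
    (Set.InjOn (conjReal f) (conjDom f) →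
      OperatorConcaveOn (conjRange f) (conjInv f) →
      OperatorMonotoneOn (conjRange f) (conjInv f) →
      ¬ BddAbove (conjRange f) →
      ∀ (ρAR : Matrix (A × R) (A × R) ℂ) (σA : Matrix A A ℂ),
        IsDensity ρAR → σA.PosSemidef →
        (⨅ σAR ∈ extensions R σA, measuredDiv f ρAR σAR)
            = measuredDiv f (partialTraceR ρAR) σA ∧
        ∃ σAR ∈ extensions R σA,
          measuredDiv f ρAR σAR = ⨅ τAR ∈ extensions R σA, measuredDiv f ρAR τAR) := by
  constructor
  · intro hconv hmono hbdd ρA σAR hρ hσ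
    -- The arguments are exchanged: `σAR` is the fixed operator and `ρA` the one to be extended.
    obtain ⟨K, hK, hKle⟩ := exists_extension_measured_le (J := -conjDom f)
      (G := fun w => -conjReal f (-w)) (T := fun p q => fTerm f q p)
      hf.convexOn_conjReal.1.neg (by rwa [bddAbove_neg]) hmono.neg_comp_neg hconv.neg_comp_neg
      (fun p q hp hq z hz => by
        convert hf.le_fTerm hq hp hz using 2
        ring)
      (fun p q hp hq b hb => by
        obtain ⟨z, hz, hbz⟩ := hf.exists_le_of_lt_fTerm hq hp hb
        exact ⟨-z, by simpa using hz, by rw [neg_neg]; linarith⟩)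
      hσ hρ.1
    have hlow : measuredDiv f ρA (partialTraceR σAR) ≤
        ⨅ ρAR ∈ extensions R ρA, measuredDiv f ρAR σAR :=
      le_iInf₂ fun τ hτ => by
        have := measuredDiv_partialTraceR_le f τ σAR
        rwa [hτ.2] at this
    have hup : measuredDiv f K σAR ≤ measuredDiv f ρA (partialTraceR σAR) :=
      iSup_le fun n => iSup_le fun M => iSup_le fun hM => hKle n M hM
    have hinf := iInf₂_le (f := fun τ (_ : τ ∈ extensions R ρA) => measuredDiv f τ σAR) K hK
    exact ⟨(hinf.trans hup).antisymm hlow, K, hK, (hup.trans hlow).antisymm hinf⟩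
  · intro hinj hconc hmono hbdd ρAR σA hρ hσ
    have hinv : ∀ z ∈ conjDom f, conjInv f (conjReal f z) = z := fun z hz =>
      hinj.leftInvOn_invFunOn hz
    obtain ⟨K, hK, hKle⟩ := exists_extension_measured_le (J := conjRange f)
      (G := conjInv f) (T := fTerm f) hf.convex_conjRange hbdd hmono hconc
      (fun p q hp hq z hz => by
        obtain ⟨y, hy, rfl⟩ := hz
        rw [hinv y hy]
        exact hf.le_fTerm hp hq hy)
      (fun p q hp hq b hb => by
        obtain ⟨z, hz, hbz⟩ := hf.exists_le_of_lt_fTerm hp hq hb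
        exact ⟨_, ⟨z, hz, rfl⟩, by rwa [hinv z hz]⟩)
      hρ.1 hσ
    have hlow : measuredDiv f (partialTraceR ρAR) σA ≤
        ⨅ σAR ∈ extensions R σA, measuredDiv f ρAR σAR :=
      le_iInf₂ fun τ hτ => by
        have := measuredDiv_partialTraceR_le f ρAR τ
        rwa [hτ.2] at this
    have hup : measuredDiv f ρAR K ≤ measuredDiv f (partialTraceR ρAR) σA :=
      iSup_le fun n => iSup_le fun M => iSup_le fun hM => hKle n M hM
    have hinf := iInf₂_le (f := fun τ (_ : τ ∈ extensions R σA) => measuredDiv f ρAR τ) K hK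
    exact ⟨(hinf.trans hup).antisymm hlow, K, hK, (hup.trans hlow).antisymm hinf⟩
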